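/- For a set $S\subseteq\mathbb R^2$, let $\mathcal T(S)$ be the set of all intersection points of pairs of distinct lines, each of which passes through two distinct points of $S$ (so $\mathcal T(S)=\emptyset$ if $S$ is collinear or empty). Let $\mathcal T^0(S)=S$ and $\mathcal T^{i+1}(S)=\mathcal T(\mathcal T^i(S))$ for $i\ge 0$. Let $S$ be a finite set of points in the plane. Then $\bigcup_{i\ge 0}\mathcal T^i(S)$ is dense in $\mathbb R^2$ if and only if $S$ is not one of the following sets: 1. the empty set; 2. a set of collinear points; 3. a set of collinear points with one additional point not collinear with them; 4. the vertices of a (nondegenerate) parallelogram; 5. the vertices of a (nondegenerate) parallelogram and the intersection of its two diagonals. -/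

import Mathlib

/-- The Euclidean plane `ℝ²`. -/
abbrev Plane : Type := EuclideanSpace ℝ (Fin 2)

/-- The set of lines that pass through two distinct points of `S`. -/
def linesOf (S : Set Plane) : Set (AffineSubspace ℝ Plane) :=
  {L | ∃ P ∈ S, ∃ Q ∈ S, P ≠ Q ∧ L = affineSpan ℝ {P, Q}}

/-- The set of intersection points of pairs of distinct lines, each of them passing through two
distinct points of `S`. It is empty if `S` is collinear, since there is then at most one line. -/
def lineIntersections (S : Set Plane) : Set Plane :=
  {X | ∃ L ∈ linesOf S, ∃ M ∈ linesOf S, L ≠ M ∧ X ∈ L ∧ X ∈ M}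

/-- `A`, `B`, `C`, `D` are, in this cyclic order, the vertices of a (nondegenerate)
parallelogram; its diagonals are the segments `AC` and `BD`. -/
def IsParallelogram (A B C D : Plane) : Prop :=
  AffineIndependent ℝ ![A, B, C] ∧ B - A = C - D

/-- `S` consists of collinear points together with one additional point that is not collinear
with them. -/
def IsCollinearPlusPoint (S : Set Plane) : Prop :=
  ∃ (R : Set Plane) (X : Plane), Collinear ℝ R ∧ ¬ Collinear ℝ (insert X R) ∧ S = insert X R

/-- `S` is the set of vertices of a parallelogram. -/
def IsParallelogramVertices (S : Set Plane) : Prop :=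
  ∃ A B C D : Plane, IsParallelogram A B C D ∧ S = {A, B, C, D}

/-- `S` consists of the vertices of a parallelogram and the intersection of its diagonals. -/
def IsParallelogramVerticesWithCenter (S : Set Plane) : Prop :=
  ∃ A B C D O : Plane, IsParallelogram A B C D ∧ segment ℝ A C ∩ segment ℝ B D = {O} ∧
    S = {A, B, C, D, O}

/-!
Let `U` be the union of the iterates. If `S` is collinear, or collinear plus one point, or consists
of the vertices of a parallelogram with or without its center, then `S` is contained in a finite set
that is closed under intersections, so `U` is finite and not dense.

Otherwise the iterates increase and `U` is itself closed under intersections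
(`lineIntersections_iUnion_subset`). Everything then rests on `dense_of_mem_triangle`: a set closed
under intersections that contains a triangle and a point in its interior is dense. Indeed, take the
interior point as the unit point of a projective frame on the triangle. Von Staudt's constructions
produce all points with positive rational homogeneous coordinates without leaving the closed
triangle (`framePoint_natCast_mem`), and every other rational point of the affine plane is an
intersection of lines through these; the rational points are dense.

A triangle with an interior point is found in `U` as follows. Since `S` is not collinear plus one
point, it contains four points in general position (`exists_inGeneralPosition`). If one of them is
inside the triangle of the others, nothing remains to be done. If they form a convex quadrilateral with
two opposite sides that are not parallel, these sides meet in a point `E`, and the intersection of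
the diagonals is interior to the triangle formed by `E` and the two vertices farther from it
(`dense_of_convex_quadrilateral_aux`). If they form a parallelogram, then `S` has a fifth point
besides its center, which together with three of the vertices forms a quadrilateral in general
position that is not a parallelogram (`dense_of_parallelogram_and_point`).
-/

/-! ### Lines, signed areas and the iteration -/

/-- Twice the signed area of the triangle `P Q X`; for `P ≠ Q` it vanishes exactly when `X` lies on
the line `PQ`. -/
def doubleArea (P Q X : Plane) : ℝ :=
  (Q 0 - P 0) * (X 1 - P 1) - (Q 1 - P 1) * (X 0 - P 0)

theorem ne_of_doubleArea_ne_zero {P Q X : Plane} (h : doubleArea P Q X ≠ 0) : P ≠ Q := by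
  rintro rfl
  simp [doubleArea] at h

theorem plane_ext {P Q : Plane} (h0 : P 0 = Q 0) (h1 : P 1 = Q 1) : P = Q := by
  ext i
  fin_cases i
  · exact h0
  · exact h1

theorem mem_line_iff {P Q X : Plane} (h : P ≠ Q) :
    X ∈ affineSpan ℝ {P, Q} ↔ doubleArea P Q X = 0 := by
  constructor
  · intro hX
    obtain ⟨r, rfl⟩ :=
      mem_affineSpan_pair_iff_exists_lineMap_eq.1 hX
    simp [doubleArea, AffineMap.lineMap_apply]
    ring
  · intro hX
    unfold doubleArea at hX
    refine mem_affineSpan_pair_iff_exists_lineMap_eq.2 ?_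
    by_cases h0 : Q 0 - P 0 = 0
    · have h1 : Q 1 - P 1 ≠ 0 := fun h1 =>
        h (plane_ext (sub_eq_zero.1 h0).symm (sub_eq_zero.1 h1).symm)
      have hX0 : X 0 - P 0 = 0 := by
        rw [h0] at hX
        have : (Q 1 - P 1) * (X 0 - P 0) = 0 := by linarith
        exact (mul_eq_zero.1 this).resolve_left h1
      refine ⟨(X 1 - P 1) / (Q 1 - P 1), plane_ext ?_ ?_⟩
      · simp [AffineMap.lineMap_apply, h0]
        linarith
      · simp [AffineMap.lineMap_apply]
        field_simp
        ring
    · refine ⟨(X 0 - P 0) / (Q 0 - P 0), plane_ext ?_ ?_⟩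
      · simp [AffineMap.lineMap_apply]
        field_simp
        ring
      · simp [AffineMap.lineMap_apply]
        field_simp
        linarith

/-- Distinct lines spanned by points of `S` and `S'` meet in at most one point. -/
theorem eq_of_mem_linesOf {S S' : Set Plane} {L M : AffineSubspace ℝ Plane} (hL : L ∈ linesOf S)
    (hM : M ∈ linesOf S') (hLM : L ≠ M) {X Y : Plane} (hXL : X ∈ L) (hXM : X ∈ M) (hYL : Y ∈ L)
    (hYM : Y ∈ M) : X = Y := by
  obtain ⟨P, -, Q, -, hPQ, rfl⟩ := hL
  obtain ⟨R, -, V, -, hRV, rfl⟩ := hM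
  by_contra h
  exact hLM ((affineSpan_pair_eq_of_mem_of_mem_of_ne hXL hYL h).symm.trans
    (affineSpan_pair_eq_of_mem_of_mem_of_ne hXM hYM h))

theorem collinear_of_subset_line {S : Set Plane} {A B : Plane}
    (h : S ⊆ (affineSpan ℝ {A, B} : AffineSubspace ℝ Plane)) : Collinear ℝ S := by
  refine (collinear_iff_exists_forall_eq_smul_vadd S).2 ⟨A, B -ᵥ A, fun X hX => ?_⟩
  obtain ⟨r, rfl⟩ :=
      mem_affineSpan_pair_iff_exists_lineMap_eq.1 (h hX)
  exact ⟨r, rfl⟩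

theorem collinear_of_doubleArea_eq_zero {S : Set Plane}
    (h : ∀ A ∈ S, ∀ B ∈ S, ∀ C ∈ S, doubleArea A B C = 0) : Collinear ℝ S := by
  by_cases hs : S.Subsingleton
  · obtain rfl | ⟨A, rfl⟩ := hs.eq_empty_or_singleton
    · exact collinear_empty ℝ Plane
    · exact collinear_singleton ℝ A
  · obtain ⟨A, hA, B, hB, hAB⟩ := Set.not_subsingleton_iff.1 hs
    exact collinear_of_subset_line fun C hC => (mem_line_iff hAB).2 (h A hA B hB C hC)

theorem doubleArea_eq_zero_of_collinear {S : Set Plane} (h : Collinear ℝ S) {A B C : Plane}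
    (hA : A ∈ S) (hB : B ∈ S) (hC : C ∈ S) : doubleArea A B C = 0 := by
  obtain ⟨v, hv⟩ := (collinear_iff_of_mem hA).1 h
  obtain ⟨b, rfl⟩ := hv B hB
  obtain ⟨c, rfl⟩ := hv C hC
  simp [doubleArea]
  ring

theorem affineIndependent_iff_doubleArea_ne_zero {A B C : Plane} :
    AffineIndependent ℝ ![A, B, C] ↔ doubleArea A B C ≠ 0 := by
  rw [affineIndependent_iff_not_collinear_set, not_iff_not]
  constructor
  · intro h
    exact doubleArea_eq_zero_of_collinear h (by simp) (by simp) (by simp)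
  · intro h
    by_cases hAB : A = B
    · subst hAB
      simpa using collinear_pair ℝ A C
    · refine collinear_of_subset_line (A := A) (B := B) ?_
      rintro X (rfl | rfl | rfl)
      · exact left_mem_affineSpan_pair ℝ _ _
      · exact right_mem_affineSpan_pair ℝ _ _
      · exact (mem_line_iff hAB).2 h

theorem lineIntersections_mono : Monotone lineIntersections := by
  rintro S T hST X ⟨L, ⟨P, hP, Q, hQ, hL⟩, M, ⟨R, hR, V, hV, hM⟩, h⟩
  exact ⟨L, ⟨P, hST hP, Q, hST hQ, hL⟩, M, ⟨R, hST hR, V, hST hV, hM⟩, h⟩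

theorem mem_lineIntersections {S : Set Plane} {P Q R V X : Plane} (hP : P ∈ S) (hQ : Q ∈ S)
    (hR : R ∈ S) (hV : V ∈ S) (hX : doubleArea P Q X = 0) (hX' : doubleArea R V X = 0)
    (hRV : R ≠ V) (h : doubleArea P Q R ≠ 0) : X ∈ lineIntersections S := by
  have hPQ := ne_of_doubleArea_ne_zero h
  refine ⟨_, ⟨P, hP, Q, hQ, hPQ, rfl⟩, _, ⟨R, hR, V, hV, hRV, rfl⟩, ?_,
    (mem_line_iff hPQ).2 hX, (mem_line_iff hRV).2 hX'⟩
  intro hl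
  apply h
  rw [← mem_line_iff hPQ, hl]
  exact left_mem_affineSpan_pair ℝ _ _

theorem exists_doubleArea_ne_zero {S : Set Plane} (h : ¬ Collinear ℝ S) :
    ∃ A ∈ S, ∃ B ∈ S, ∃ C ∈ S, doubleArea A B C ≠ 0 := by
  by_contra! hc
  exact h (collinear_of_doubleArea_eq_zero hc)

theorem subset_lineIntersections {S : Set Plane} (h : ¬ Collinear ℝ S) :
    S ⊆ lineIntersections S := by
  intro P hP
  obtain ⟨A, hA, B, hB, C, hC, hABC⟩ := exists_doubleArea_ne_zero h
  obtain ⟨Q, hQ, R, hR, hPQR⟩ : ∃ Q ∈ S, ∃ R ∈ S, doubleArea P Q R ≠ 0 := by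
    by_contra! hc
    apply hABC
    have h1 := hc A hA B hB
    have h2 := hc B hB C hC
    have h3 := hc C hC A hA
    unfold doubleArea at *
    linarith
  refine mem_lineIntersections hP hQ hR hP (by simp [doubleArea])
    (by simp [doubleArea, mul_comm]) ?_ hPQR
  rintro rfl
  simp [doubleArea] at hPQR

/-- The iterates of a non-collinear set increase, so every line through two points of their union
is already a line of some iterate. -/
theorem lineIntersections_iUnion_subset {S : Set Plane} (h : ¬ Collinear ℝ S) :
    lineIntersections (⋃ i : ℕ, lineIntersections^[i] S) ⊆ ⋃ i : ℕ, lineIntersections^[i] S := by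
  have hmono : Monotone fun i : ℕ => lineIntersections^[i] S :=
    lineIntersections_mono.monotone_iterate_of_le_map (subset_lineIntersections h)
  rintro X ⟨L, ⟨P, hP, Q, hQ, hL⟩, M, ⟨R, hR, V, hV, hM⟩, hX⟩
  obtain ⟨i, hP⟩ := Set.mem_iUnion.1 hP
  obtain ⟨j, hQ⟩ := Set.mem_iUnion.1 hQ
  obtain ⟨k, hR⟩ := Set.mem_iUnion.1 hR
  obtain ⟨l, hV⟩ := Set.mem_iUnion.1 hV
  refine Set.mem_iUnion.2 ⟨(i + j + k + l) + 1, ?_⟩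
  rw [Function.iterate_succ_apply']
  exact ⟨L, ⟨P, hmono (by omega) hP, Q, hmono (by omega) hQ, hL⟩,
    M, ⟨R, hmono (by omega) hR, V, hmono (by omega) hV, hM⟩, hX⟩

theorem not_dense_iUnion_of_subset {S F : Set Plane} (hF : F.Finite) (hSF : S ⊆ F)
    (h : lineIntersections F ⊆ F) : ¬ Dense (⋃ i : ℕ, lineIntersections^[i] S) := by
  have hsub : (⋃ i : ℕ, lineIntersections^[i] S) ⊆ F := by
    refine Set.iUnion_subset fun i => ?_
    induction i with
    | zero => exact hSF
    | succ i ih =>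
      rw [Function.iterate_succ_apply']
      exact (lineIntersections_mono ih).trans h
  intro hd
  have hu : F = Set.univ := by
    rw [← hF.isClosed.closure_eq]
    exact (hd.mono hsub).closure_eq
  have : Infinite Plane := Module.Free.infinite ℝ Plane
  exact Set.infinite_univ (hu ▸ hF)

/-! ### Rational points of a projective frame -/

/-- The point with homogeneous coordinates `w` in the projective frame with vertices `T 0`, `T 1`,
`T 2` and unit point proportional to `p 0 • T 0 + p 1 • T 1 + p 2 • T 2`. The coordinates describe
a point at infinity when `p ⬝ᵥ w = 0`, and the value is then meaningless. -/
noncomputable def framePoint (T : Fin 3 → Plane) (p w : Fin 3 → ℝ) : Plane :=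
  (p ⬝ᵥ w)⁻¹ • ∑ i, (p i * w i) • T i

theorem framePoint_smul (T : Fin 3 → Plane) (p w : Fin 3 → ℝ) {c : ℝ} (hc : c ≠ 0) :
    framePoint T p (c • w) = framePoint T p w := by
  unfold framePoint
  rw [dotProduct_smul, smul_eq_mul, mul_inv, mul_comm, mul_smul]
  congr 1
  rw [Finset.smul_sum]
  refine Finset.sum_congr rfl fun i _ => ?_
  rw [smul_smul]
  congr 1
  simp
  field_simp

theorem doubleArea_framePoint (T : Fin 3 → Plane) (p : Fin 3 → ℝ) {u v w : Fin 3 → ℝ}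
    (hu : p ⬝ᵥ u ≠ 0) (hv : p ⬝ᵥ v ≠ 0) (hw : p ⬝ᵥ w ≠ 0) :
    doubleArea (framePoint T p u) (framePoint T p v) (framePoint T p w) =
      p 0 * p 1 * p 2 / ((p ⬝ᵥ u) * (p ⬝ᵥ v) * (p ⬝ᵥ w)) * Matrix.det (Matrix.of ![u, v, w]) *
        doubleArea (T 0) (T 1) (T 2) := by
  simp only [dotProduct, Fin.sum_univ_three] at hu hv hw
  simp only [doubleArea, framePoint, Matrix.det_fin_three, dotProduct, Fin.sum_univ_three,
    PiLp.smul_apply, PiLp.add_apply, smul_eq_mul, Matrix.of_apply, Matrix.cons_val]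
  field_simp
  ring

section Frame

variable {U : Set Plane} {T : Fin 3 → Plane} {p : Fin 3 → ℝ}

/-- If `u`, `u'` and `v`, `v'` are points of a set closed under intersections and `w` is linearly
dependent on either pair, then `w` is the intersection of the two lines; the vector `t` witnesses
that `v` and `v'` are different points. -/
theorem framePoint_mem_of_det_eq_zero (hU : lineIntersections U ⊆ U)
    (hT : doubleArea (T 0) (T 1) (T 2) ≠ 0) (hp : ∀ i, p i ≠ 0) {u u' v v' w t : Fin 3 → ℝ}
    (hu : p ⬝ᵥ u ≠ 0) (hu' : p ⬝ᵥ u' ≠ 0) (hv : p ⬝ᵥ v ≠ 0) (hv' : p ⬝ᵥ v' ≠ 0)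
    (hw : p ⬝ᵥ w ≠ 0) (ht : p ⬝ᵥ t ≠ 0)
    (hmu : framePoint T p u ∈ U) (hmu' : framePoint T p u' ∈ U)
    (hmv : framePoint T p v ∈ U) (hmv' : framePoint T p v' ∈ U)
    (h1 : Matrix.det (Matrix.of ![u, u', w]) = 0) (h2 : Matrix.det (Matrix.of ![v, v', w]) = 0)
    (h3 : Matrix.det (Matrix.of ![u, u', v]) ≠ 0) (h4 : Matrix.det (Matrix.of ![v, v', t]) ≠ 0) :
    framePoint T p w ∈ U := by
  have hne : ∀ {x y z : Fin 3 → ℝ}, p ⬝ᵥ x ≠ 0 → p ⬝ᵥ y ≠ 0 → p ⬝ᵥ z ≠ 0 →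
      Matrix.det (Matrix.of ![x, y, z]) ≠ 0 →
      doubleArea (framePoint T p x) (framePoint T p y) (framePoint T p z) ≠ 0 := by
    intro x y z hx hy hz hd
    rw [doubleArea_framePoint T p hx hy hz]
    have := hp 0
    have := hp 1
    have := hp 2
    positivity
  refine hU (mem_lineIntersections hmu hmu' hmv hmv' ?_ ?_
    (ne_of_doubleArea_ne_zero (hne hv hv' ht h4)) (hne hu hu' hv h3))
  · rw [doubleArea_framePoint T p hu hu' hw, h1, mul_zero, zero_mul]
  · rw [doubleArea_framePoint T p hv hv' hw, h2, mul_zero, zero_mul]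

theorem dotProduct_pos_of_nonneg (hp : ∀ i, 0 < p i) {a b c : ℝ} (ha : 0 ≤ a) (hb : 0 ≤ b)
    (hc : 0 ≤ c) (h : 0 < a + b + c) : 0 < p ⬝ᵥ ![a, b, c] := by
  simp only [dotProduct, Fin.sum_univ_three, Matrix.cons_val]
  have h0 := hp 0
  have h1 := hp 1
  have h2 := hp 2
  rcases ha.eq_or_lt with rfl | ha
  · rcases hb.eq_or_lt with rfl | hb
    · have : 0 < c := by linarith
      positivity
    · positivity
  · positivity

/-- Von Staudt's construction of the rational points, arranged so that every auxiliary point has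
nonnegative coordinates: it lies in the closed triangle, and none escapes to infinity. -/
theorem framePoint_natCast_mem (hU : lineIntersections U ⊆ U)
    (hT : doubleArea (T 0) (T 1) (T 2) ≠ 0) (hp : ∀ i, 0 < p i)
    (hTU : ∀ i, T i ∈ U) (h111 : framePoint T p ![1, 1, 1] ∈ U)
    {k n m : ℕ} (hk : 0 < k) (hn : 0 < n) (hm : 0 < m) : framePoint T p ![k, n, m] ∈ U := by
  have hp' : ∀ i, p i ≠ 0 := fun i => (hp i).ne'
  have e0 : framePoint T p ![1, 0, 0] ∈ U := by
    have := hTU 0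
    have h := hp' 0
    simpa [framePoint, dotProduct, Fin.sum_univ_three, h] using this
  have e1 : framePoint T p ![0, 1, 0] ∈ U := by
    have := hTU 1
    have h := hp' 1
    simpa [framePoint, dotProduct, Fin.sum_univ_three, h] using this
  have e2 : framePoint T p ![0, 0, 1] ∈ U := by
    have := hTU 2
    have h := hp' 2
    simpa [framePoint, dotProduct, Fin.sum_univ_three, h] using this
  have step : ∀ {a a' a'' b b' b'' c c' c'' d d' d'' x x' x'' : ℕ} (t t' t'' : ℕ),
      framePoint T p ![a, a', a''] ∈ U → framePoint T p ![b, b', b''] ∈ U →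
      framePoint T p ![c, c', c''] ∈ U → framePoint T p ![d, d', d''] ∈ U →
      0 < a + a' + a'' → 0 < b + b' + b'' → 0 < c + c' + c'' → 0 < d + d' + d'' →
      0 < x + x' + x'' → 0 < t + t' + t'' →
      Matrix.det !![(a : ℝ), a', a''; b, b', b''; x, x', x''] = 0 →
      Matrix.det !![(c : ℝ), c', c''; d, d', d''; x, x', x''] = 0 →
      Matrix.det !![(a : ℝ), a', a''; b, b', b''; c, c', c''] ≠ 0 →
      Matrix.det !![(c : ℝ), c', c''; d, d', d''; t, t', t''] ≠ 0 →
      framePoint T p ![x, x', x''] ∈ U := by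
    intro a a' a'' b b' b'' c c' c'' d d' d'' x x' x'' t t' t'' ha hb hc hd pa pb pc pd px pt
      h1 h2 h3 h4
    have pos : ∀ {x y z : ℕ}, 0 < x + y + z → p ⬝ᵥ ![(x : ℝ), y, z] ≠ 0 := fun {x y z} h =>
      (dotProduct_pos_of_nonneg hp (Nat.cast_nonneg x) (Nat.cast_nonneg y) (Nat.cast_nonneg z)
        (by exact_mod_cast h)).ne'
    exact framePoint_mem_of_det_eq_zero hU hT hp' (pos pa) (pos pb) (pos pc) (pos pd) (pos px)
      (pos pt) ha hb hc hd h1 h2 h3 h4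
  have e011 : framePoint T p ![0, 1, 1] ∈ U := by
    have := @step 1 0 0 1 1 1 0 1 0 0 0 1 0 1 1 1 0 0
    simp [Matrix.det_fin_three] at this
    exact this e0 h111 e1 e2
  have e101 : framePoint T p ![1, 0, 1] ∈ U := by
    have := @step 0 1 0 1 1 1 1 0 0 0 0 1 1 0 1 0 1 0
    simp [Matrix.det_fin_three] at this
    exact this e1 h111 e0 e2
  have e110 : framePoint T p ![1, 1, 0] ∈ U := by
    have := @step 0 0 1 1 1 1 1 0 0 0 1 0 1 1 0 0 0 1
    simp [Matrix.det_fin_three] at this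
    exact this e2 h111 e0 e1
  -- `(1, n + 1, 1) = (1, n, 0) + (0, 1, 1) = (n + 1) • (0, 1, 0) + (1, 0, 1)`
  have h1n0 : ∀ n : ℕ, framePoint T p ![1, n, 0] ∈ U := by
    intro n
    induction n with
    | zero => simpa using e0
    | succ n ih =>
      have h : framePoint T p ![1, (n + 1 : ℕ), 1] ∈ U := by
        have := @step 1 n 0 0 1 1 0 1 0 1 0 1 1 (n + 1) 1 1 0 0
        simp [Matrix.det_fin_three] at this
        simpa using this ih e011 e1 e101
      have := @step 0 0 1 1 (n + 1) 1 1 0 0 0 1 0 1 (n + 1) 0 0 0 1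
      simp [Matrix.det_fin_three] at this
      have hn : (0 : ℝ) ≤ n := Nat.cast_nonneg n
      simpa using this e2 (by simpa using h) e0 e1 (fun h => by linarith)
  have h10m : ∀ m : ℕ, framePoint T p ![1, 0, m] ∈ U := by
    intro m
    induction m with
    | zero => simpa using e0
    | succ m ih =>
      have h : framePoint T p ![1, 1, (m + 1 : ℕ)] ∈ U := by
        have := @step 1 0 m 0 1 1 0 0 1 1 1 0 1 1 (m + 1) 1 0 0
        simp [Matrix.det_fin_three] at this
        simpa using this ih e011 e2 e110
      have := @step 0 1 0 1 1 (m + 1) 1 0 0 0 0 1 1 0 (m + 1) 0 1 0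
      simp [Matrix.det_fin_three] at this
      simpa using this e1 (by simpa using h) e0 e2 (by positivity)
  have h1nm : ∀ n m : ℕ, framePoint T p ![1, n, m] ∈ U := by
    intro n m
    have := @step 0 1 0 1 0 m 0 0 1 1 n 0 1 n m 0 1 0
    simp [Matrix.det_fin_three] at this
    exact this e1 (h10m m) e2 (h1n0 n)
  have h0nm : ∀ n m : ℕ, 0 < m → framePoint T p ![0, n, m] ∈ U := by
    intro n m hm
    have := @step 1 0 0 1 n m 0 1 0 0 0 1 0 n m 1 0 0
    simp [Matrix.det_fin_three] at this
    exact this e0 (h1nm n m) e1 e2 (by omega) (by ring) hm.ne'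
  -- `(k + 1, n, 1) = (k, n, 0) + (1, 0, 1) = (k + 1) • (1, 0, 0) + (0, n, 1)`
  have hkn0 : ∀ k n : ℕ, 0 < n → framePoint T p ![(k + 1 : ℕ), n, 0] ∈ U := by
    intro k n hn
    induction k with
    | zero => simpa using h1n0 n
    | succ k ih =>
      have h : framePoint T p ![(k + 1 + 1 : ℕ), n, 1] ∈ U := by
        have := @step (k + 1) n 0 1 0 1 1 0 0 0 n 1 (k + 1 + 1) n 1 0 1 0
        simp [Matrix.det_fin_three] at this
        simpa using this (by simpa using ih) e101 e0 (by simpa using h0nm n 1 one_pos) (by ring) hn.ne'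
      have := @step 0 0 1 (k + 1 + 1) n 1 1 0 0 0 1 0 (k + 1 + 1) n 0 0 0 1
      simp [Matrix.det_fin_three] at this
      simpa using this e2 (by simpa using h) e0 e1 (by ring) hn.ne'
  obtain ⟨k, rfl⟩ := Nat.exists_eq_succ_of_ne_zero hk.ne'
  have := @step 0 0 1 (k + 1) n 0 1 0 0 0 n m (k + 1) n m 0 1 0
  simp [Matrix.det_fin_three] at this
  simpa using this e2 (by simpa using hkn0 k n hn) e0 (h0nm n m hm) (Or.inl hn) (by ring) (by ring) hn.ne' hm.ne'

/-- An integer point `w` off the line at infinity is the intersection of two lines, each of which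
joins two points with positive coordinates, namely some positive `f` and `w + N • f`; on one of the
lines `f = (1, 1, 1)`. -/
theorem framePoint_intCast_mem (hU : lineIntersections U ⊆ U)
    (hT : doubleArea (T 0) (T 1) (T 2) ≠ 0) (hp : ∀ i, 0 < p i)
    (hTU : ∀ i, T i ∈ U) (h111 : framePoint T p ![1, 1, 1] ∈ U) {a b c : ℤ}
    (hw : p ⬝ᵥ ![(a : ℝ), b, c] ≠ 0) : framePoint T p ![a, b, c] ∈ U := by
  have hp' : ∀ i, p i ≠ 0 := fun i => (hp i).ne'
  have hpos : ∀ {a b c : ℤ}, 0 < a → 0 < b → 0 < c → p ⬝ᵥ ![(a : ℝ), b, c] ≠ 0 ∧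
      framePoint T p ![a, b, c] ∈ U := by
    intro a b c ha hb hc
    refine ⟨(dotProduct_pos_of_nonneg hp (by positivity) (by positivity) (by positivity)
      (by positivity)).ne', ?_⟩
    lift a to ℕ using ha.le
    lift b to ℕ using hb.le
    lift c to ℕ using hc.le
    exact_mod_cast framePoint_natCast_mem hU hT hp hTU h111 (by omega : 0 < a)
      (by omega : 0 < b) (by omega : 0 < c)
  obtain ⟨N, hN, hNa, hNb, hNc⟩ : ∃ N : ℤ, 0 < N ∧ 0 < a + N ∧ 0 < b + N ∧ 0 < c + N :=
    ⟨|a| + |b| + |c| + 1, by positivity, by grind, by grind, by grind⟩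
  have key : ∀ x y z : ℤ, 0 < x → 0 < y → 0 < z →
      Matrix.det !![(1 : ℝ), 1, 1; a, b, c; x, y, z] ≠ 0 → framePoint T p ![a, b, c] ∈ U := by
    intro x y z hx hy hz hdet
    obtain ⟨q1, m1⟩ := hpos one_pos one_pos one_pos
    obtain ⟨q2, m2⟩ := hpos hNa hNb hNc
    obtain ⟨q3, m3⟩ := hpos hx hy hz
    obtain ⟨q4, m4⟩ := hpos (by nlinarith : 0 < a + N * x) (by nlinarith : 0 < b + N * y)
      (by nlinarith : 0 < c + N * z)
    simp only [Matrix.det_fin_three, Matrix.of_apply, Matrix.cons_val] at hdet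
    refine framePoint_mem_of_det_eq_zero hU hT hp' q1 q2 q3 q4 hw q1 m1 m2 m3 m4 ?_ ?_ ?_ ?_ <;>
      simp only [Matrix.det_fin_three, Matrix.of_apply, Matrix.cons_val] <;> push_cast
    · ring
    · ring
    · intro h
      exact hdet (by linear_combination h)
    · intro h
      exact hdet (by linear_combination -h)
  -- `(1, 2, 1)` or `(2, 1, 1)` is independent of `(1, 1, 1)` and `w`, unless these are proportional.
  by_cases hbc : b = c
  · by_cases hac : a = c
    · subst hbc hac
      have ha : (a : ℝ) ≠ 0 := by
        intro h
        apply hw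
        simp [h, dotProduct, Fin.sum_univ_three]
      have := framePoint_smul T p ![1, 1, 1] ha
      simp at this
      rwa [this]
    · refine key 1 2 1 one_pos two_pos one_pos ?_
      have : (a : ℝ) - c ≠ 0 := sub_ne_zero.2 (by exact_mod_cast hac)
      simp [Matrix.det_fin_three]
      intro h
      exact this (by linarith)
  · refine key 2 1 1 two_pos one_pos one_pos ?_
    have : (b : ℝ) - c ≠ 0 := sub_ne_zero.2 (by exact_mod_cast hbc)
    simp [Matrix.det_fin_three]
    intro h
    exact this (by linarith)

theorem tendsto_intFloor_mul_div_atTop (x : ℝ) :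
    Filter.Tendsto (fun n : ℕ => (⌊(n : ℝ) * x⌋ : ℝ) / n) Filter.atTop (nhds x) := by
  have hl : Filter.Tendsto (fun n : ℕ => x - 1 / (n : ℝ)) Filter.atTop (nhds x) := by
    simpa using tendsto_const_nhds.sub (tendsto_one_div_atTop_nhds_zero_nat (𝕜 := ℝ))
  refine tendsto_of_tendsto_of_tendsto_of_le_of_le' hl tendsto_const_nhds ?_ ?_
  · filter_upwards [Filter.eventually_gt_atTop 0] with n hn
    have hn' : (0 : ℝ) < n := by exact_mod_cast hn
    rw [le_div_iff₀ hn', sub_mul, one_div, inv_mul_cancel₀ hn'.ne']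
    have := Int.sub_one_lt_floor ((n : ℝ) * x)
    linarith
  · filter_upwards [Filter.eventually_gt_atTop 0] with n hn
    have hn' : (0 : ℝ) < n := by exact_mod_cast hn
    rw [div_le_iff₀ hn', mul_comm x]
    exact Int.floor_le _

theorem exists_barycentric {A B C : Plane} (h : doubleArea A B C ≠ 0) (X : Plane) :
    ∃ a b c : ℝ, a + b + c = 1 ∧ X = a • A + b • B + c • C := by
  refine ⟨doubleArea X B C / doubleArea A B C, doubleArea A X C / doubleArea A B C,
    doubleArea A B X / doubleArea A B C, ?_, plane_ext ?_ ?_⟩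
  · field_simp
    unfold doubleArea
    ring
  all_goals
    simp only [PiLp.add_apply, PiLp.smul_apply, smul_eq_mul]
    field_simp
    unfold doubleArea
    ring

/-- The rational points of the frame are dense, since a point depends continuously on its
homogeneous coordinates away from the line at infinity. -/
theorem dense_of_framePoint_mem (hU : lineIntersections U ⊆ U)
    (hT : doubleArea (T 0) (T 1) (T 2) ≠ 0) (hp : ∀ i, 0 < p i)
    (hTU : ∀ i, T i ∈ U) (h111 : framePoint T p ![1, 1, 1] ∈ U) : Dense U := by
  intro X
  obtain ⟨a, b, c, habc, hX⟩ := exists_barycentric hT X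
  have h0 := (hp 0).ne'
  have h1 := (hp 1).ne'
  have h2 := (hp 2).ne'
  have hw : p ⬝ᵥ ![a / p 0, b / p 1, c / p 2] = 1 := by
    simp only [dotProduct, Fin.sum_univ_three, Matrix.cons_val]
    field_simp
    exact habc
  have hXw : framePoint T p ![a / p 0, b / p 1, c / p 2] = X := by
    rw [framePoint, hw, hX, Fin.sum_univ_three]
    simp only [Matrix.cons_val]
    simp [mul_div_cancel₀ _ h0, mul_div_cancel₀ _ h1, mul_div_cancel₀ _ h2]
  let z : ℕ → Fin 3 → ℝ := fun n => ![(⌊(n : ℝ) * (a / p 0)⌋ : ℝ) / n,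
    (⌊(n : ℝ) * (b / p 1)⌋ : ℝ) / n, (⌊(n : ℝ) * (c / p 2)⌋ : ℝ) / n]
  have hz : Filter.Tendsto z Filter.atTop (nhds ![a / p 0, b / p 1, c / p 2]) := by
    rw [tendsto_pi_nhds]
    intro i
    fin_cases i
    · exact tendsto_intFloor_mul_div_atTop _
    · exact tendsto_intFloor_mul_div_atTop _
    · exact tendsto_intFloor_mul_div_atTop _
  have hdot : Continuous fun w : Fin 3 → ℝ => p ⬝ᵥ w := by
    unfold dotProduct
    fun_prop
  have hcont : ContinuousAt (framePoint T p) ![a / p 0, b / p 1, c / p 2] := by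
    unfold framePoint
    simp only [Fin.sum_univ_three]
    refine ContinuousAt.smul (hdot.continuousAt.inv₀ (by rw [hw]; exact one_ne_zero)) ?_
    fun_prop
  have hlim : Filter.Tendsto (fun n => framePoint T p (z n)) Filter.atTop (nhds X) := by
    rw [← hXw]
    exact hcont.tendsto.comp hz
  have hne : ∀ᶠ n in Filter.atTop, p ⬝ᵥ z n ≠ 0 := by
    refine ((hdot.tendsto _).comp hz).eventually_ne ?_
    rw [hw]
    exact one_ne_zero
  refine mem_closure_of_tendsto hlim ?_
  filter_upwards [hne, Filter.eventually_gt_atTop 0] with n hn hn0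
  have hn' : (n : ℝ)⁻¹ ≠ 0 := inv_ne_zero (by exact_mod_cast hn0.ne')
  have hzn : z n = (n : ℝ)⁻¹ • ![(⌊(n : ℝ) * (a / p 0)⌋ : ℝ), (⌊(n : ℝ) * (b / p 1)⌋ : ℝ),
      (⌊(n : ℝ) * (c / p 2)⌋ : ℝ)] := by
    simp [z, div_eq_inv_mul]
  rw [hzn, dotProduct_smul, smul_eq_mul] at hn
  rw [hzn, framePoint_smul T p _ hn']
  exact framePoint_intCast_mem hU hT hp hTU h111 (right_ne_zero_of_mul hn)

end Frame

/-- A set closed under intersections that contains a triangle and a point in its interior is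
dense. The weights of the interior point need not be normalized. -/
theorem dense_of_mem_triangle {U : Set Plane} (hU : lineIntersections U ⊆ U) {A B C P : Plane}
    (hA : A ∈ U) (hB : B ∈ U) (hC : C ∈ U) (hP : P ∈ U) (h : doubleArea A B C ≠ 0) {a b c : ℝ}
    (ha : 0 < a) (hb : 0 < b) (hc : 0 < c)
    (hPabc : (a + b + c) • P = a • A + b • B + c • C) : Dense U := by
  refine dense_of_framePoint_mem (T := ![A, B, C]) (p := ![a, b, c]) hU h ?_ ?_ ?_
  · intro i
    fin_cases i
    · exact ha
    · exact hb
    · exact hc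
  · intro i
    fin_cases i
    · exact hA
    · exact hB
    · exact hC
  · have hs : a + b + c ≠ 0 := by positivity
    have : framePoint ![A, B, C] ![a, b, c] ![1, 1, 1] = P := by
      simp only [framePoint, dotProduct, Fin.sum_univ_three, Matrix.cons_val, mul_one]
      rw [← hPabc, smul_smul, inv_mul_cancel₀ hs, one_smul]
    rwa [this]

/-! ### Four points in general position -/

/-- No three of the four points are collinear. -/
def InGeneralPosition (A B C D : Plane) : Prop :=
  doubleArea A B C ≠ 0 ∧ doubleArea A B D ≠ 0 ∧ doubleArea A C D ≠ 0 ∧ doubleArea B C D ≠ 0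

/-- The convex quadrilateral `A D B C`, with diagonals `AB` and `CD` meeting in `O`, whose opposite
sides `AC` and `BD` meet in `E`: then `O` is interior to the triangle formed by `E` and by those
two vertices, one on each of these sides, which are farther from `E`. -/
theorem dense_of_convex_quadrilateral_aux {U : Set Plane} (hU : lineIntersections U ⊆ U)
    {A B C D : Plane} (hA : A ∈ U) (hB : B ∈ U) (hC : C ∈ U) (hD : D ∈ U)
    (hABC : doubleArea A B C ≠ 0) {a b c : ℝ} (ha : 0 < a) (hb : 0 < b) (hc : c < 0)
    (habc : a + b + c = 1) (hDabc : D = a • A + b • B + c • C) (hac : a + c ≠ 0) : Dense U := by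
  have hab : 0 < a + b := by positivity
  have hbac : doubleArea B D A = c * doubleArea A B C := by
    rw [hDabc]
    obtain rfl : a = 1 - b - c := by linarith
    simp only [doubleArea, PiLp.add_apply, PiLp.smul_apply, smul_eq_mul]
    ring
  have hCDA : doubleArea C D A = -b * doubleArea A B C := by
    rw [hDabc]
    obtain rfl : a = 1 - b - c := by linarith
    simp only [doubleArea, PiLp.add_apply, PiLp.smul_apply, smul_eq_mul]
    ring
  have hBD : B ≠ D := ne_of_doubleArea_ne_zero (hbac ▸ mul_ne_zero hc.ne hABC)
  have hCD : C ≠ D :=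
    ne_of_doubleArea_ne_zero (hCDA ▸ mul_ne_zero (neg_ne_zero.2 hb.ne') hABC)
  have hACB : doubleArea A C B ≠ 0 := by
    intro h
    apply hABC
    unfold doubleArea at *
    linarith
  obtain ⟨O, hO⟩ : ∃ O, O = (a + b)⁻¹ • (a • A + b • B) := ⟨_, rfl⟩
  obtain ⟨E, hE⟩ : ∃ E, E = (a + c)⁻¹ • (a • A + c • C) := ⟨_, rfl⟩
  have hO' : (a + b) • O = a • A + b • B := by
    rw [hO, smul_smul, mul_inv_cancel₀ hab.ne', one_smul]
  have hE' : (a + c) • E = a • A + c • C := by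
    rw [hE, smul_smul, mul_inv_cancel₀ hac, one_smul]
  have hOU : O ∈ U := by
    refine hU (mem_lineIntersections hA hB hC hD ?_ ?_ hCD hABC)
    · rw [hO]
      simp only [doubleArea, PiLp.add_apply, PiLp.smul_apply, smul_eq_mul]
      field_simp
      ring
    · rw [hO, hDabc]
      obtain rfl : c = 1 - a - b := by linarith
      simp only [doubleArea, PiLp.add_apply, PiLp.smul_apply, smul_eq_mul]
      field_simp
      ring
  have hEU : E ∈ U := by
    refine hU (mem_lineIntersections hA hC hB hD ?_ ?_ hBD hACB)
    · rw [hE]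
      simp only [doubleArea, PiLp.add_apply, PiLp.smul_apply, smul_eq_mul]
      field_simp
      ring
    · rw [hE, hDabc]
      obtain rfl : b = 1 - a - c := by linarith
      simp only [doubleArea, PiLp.add_apply, PiLp.smul_apply, smul_eq_mul]
      field_simp
      ring
  rcases lt_or_gt_of_ne hac with hac' | hac'
  · refine dense_of_mem_triangle hU hEU hD hA hOU (a := -(a + c)) (b := 1) (c := a) ?_
      (by linarith) one_pos ha ?_
    · have : doubleArea E D A = -(b * c) / (a + c) * doubleArea A B C := by
        rw [hE, hDabc]
        obtain rfl : b = 1 - a - c := by linarith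
        simp only [doubleArea, PiLp.add_apply, PiLp.smul_apply, smul_eq_mul]
        field_simp
        ring
      rw [this]
      exact mul_ne_zero (div_ne_zero (neg_ne_zero.2 (mul_ne_zero hb.ne' hc.ne)) hac) hABC
    · rw [show -(a + c) + 1 + a = a + b by linarith, hO', neg_smul, hE', hDabc]
      module
  · refine dense_of_mem_triangle hU hEU hB hC hOU (a := a + c) (b := b) (c := -c) ?_
      hac' hb (by linarith) ?_
    · have : doubleArea E B C = a / (a + c) * doubleArea A B C := by
        rw [hE]
        simp only [doubleArea, PiLp.add_apply, PiLp.smul_apply, smul_eq_mul]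
        field_simp
        ring
      rw [this]
      positivity
    · rw [show a + c + b + -c = a + b by ring, hO', hE']
      module

theorem dense_of_convex_quadrilateral {U : Set Plane} (hU : lineIntersections U ⊆ U)
    {A B C D : Plane} (hA : A ∈ U) (hB : B ∈ U) (hC : C ∈ U) (hD : D ∈ U)
    (hABC : doubleArea A B C ≠ 0) {a b c : ℝ} (ha : 0 < a) (hb : 0 < b) (hc : c < 0)
    (habc : a + b + c = 1) (hDabc : D = a • A + b • B + c • C) (hne : D + C ≠ A + B) :
    Dense U := by
  by_cases hac : a + c = 0
  · have hbc : b + c ≠ 0 := by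
      intro hbc
      obtain rfl : c = -1 := by linarith
      obtain rfl : a = 1 := by linarith
      obtain rfl : b = 1 := by linarith
      apply hne
      rw [hDabc]
      module
    refine dense_of_convex_quadrilateral_aux hU hB hA hC hD (fun h => hABC ?_) hb ha hc
      (by linarith) (by rw [hDabc]; abel) hbc
    unfold doubleArea at *
    linarith
  · exact dense_of_convex_quadrilateral_aux hU hA hB hC hD hABC ha hb hc habc hDabc hac

/-- A set closed under intersections that contains four points in general position, not the vertices
of a parallelogram in any order, is dense. The signs of the barycentric coordinates of `D` tell
whether the four points form a triangle with an interior point or a convex quadrilateral. -/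
theorem dense_of_inGeneralPosition {U : Set Plane} (hU : lineIntersections U ⊆ U)
    {A B C D : Plane} (hA : A ∈ U) (hB : B ∈ U) (hC : C ∈ U) (hD : D ∈ U)
    (h : InGeneralPosition A B C D) (h1 : D + C ≠ A + B) (h2 : D + B ≠ A + C)
    (h3 : D + A ≠ B + C) : Dense U := by
  obtain ⟨hABC, hABD, hACD, hBCD⟩ := h
  obtain ⟨a, b, c, habc, hDabc⟩ := exists_barycentric hABC D
  have haD : doubleArea B C D = a * doubleArea A B C := by
    rw [hDabc]
    obtain rfl : a = 1 - b - c := by linarith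
    simp only [doubleArea, PiLp.add_apply, PiLp.smul_apply, smul_eq_mul]
    ring
  have hbD : doubleArea A C D = -b * doubleArea A B C := by
    rw [hDabc]
    obtain rfl : a = 1 - b - c := by linarith
    simp only [doubleArea, PiLp.add_apply, PiLp.smul_apply, smul_eq_mul]
    ring
  have hcD : doubleArea A B D = c * doubleArea A B C := by
    rw [hDabc]
    obtain rfl : a = 1 - b - c := by linarith
    simp only [doubleArea, PiLp.add_apply, PiLp.smul_apply, smul_eq_mul]
    ring
  have ha : a ≠ 0 := by
    rintro rfl
    exact hBCD (by rw [haD, zero_mul])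
  have hb : b ≠ 0 := by
    rintro rfl
    exact hACD (by rw [hbD, neg_zero, zero_mul])
  have hc : c ≠ 0 := by
    rintro rfl
    exact hABD (by rw [hcD, zero_mul])
  have hDBC : doubleArea D B C ≠ 0 := fun h => hBCD (by unfold doubleArea at *; linarith)
  have hDAC : doubleArea D A C ≠ 0 := fun h => hACD (by unfold doubleArea at *; linarith)
  have hDAB : doubleArea D A B ≠ 0 := fun h => hABD (by unfold doubleArea at *; linarith)
  have hACB : doubleArea A C B ≠ 0 := fun h => hABC (by unfold doubleArea at *; linarith)
  have hBCA : doubleArea B C A ≠ 0 := fun h => hABC (by unfold doubleArea at *; linarith)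
  rcases lt_or_gt_of_ne ha with ha | ha <;> rcases lt_or_gt_of_ne hb with hb | hb <;>
    rcases lt_or_gt_of_ne hc with hc | hc
  · linarith
  · refine dense_of_mem_triangle hU hD hA hB hC hDAB one_pos (neg_pos.2 ha) (neg_pos.2 hb) ?_
    rw [show 1 + -a + -b = c by linarith, hDabc]
    module
  · refine dense_of_mem_triangle hU hD hA hC hB hDAC one_pos (neg_pos.2 ha) (neg_pos.2 hc) ?_
    rw [show 1 + -a + -c = b by linarith, hDabc]
    module
  · exact dense_of_convex_quadrilateral hU hB hC hA hD hBCA hb hc ha (by linarith)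
      (by rw [hDabc]; abel) h3
  · refine dense_of_mem_triangle hU hD hB hC hA hDBC one_pos (neg_pos.2 hb) (neg_pos.2 hc) ?_
    rw [show 1 + -b + -c = a by linarith, hDabc]
    module
  · exact dense_of_convex_quadrilateral hU hA hC hB hD hACB ha hc hb (by linarith)
      (by rw [hDabc]; abel) h2
  · exact dense_of_convex_quadrilateral hU hA hB hC hD hABC ha hb hc habc hDabc h1
  · exact dense_of_mem_triangle hU hA hB hC hD hABC ha hb hc (by rw [habc, one_smul, hDabc])

theorem inGeneralPosition_of_mem_sides {A B C D E : Plane} (hABC : doubleArea A B C ≠ 0)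
    (hD : doubleArea A B D = 0) (hDA : D ≠ A) (hDB : D ≠ B) (hE : doubleArea B C E = 0)
    (hEB : E ≠ B) (hEC : E ≠ C) : InGeneralPosition A D C E := by
  obtain ⟨a, b, c, habc, rfl⟩ := exists_barycentric hABC D
  obtain ⟨a', b', c', habc', rfl⟩ := exists_barycentric hABC E
  obtain rfl : c = 0 := by
    have : c * doubleArea A B C = 0 := by
      rw [← hD]
      obtain rfl : a = 1 - b - c := by linarith
      simp only [doubleArea, PiLp.add_apply, PiLp.smul_apply, smul_eq_mul]
      ring
    exact (mul_eq_zero.1 this).resolve_right hABC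
  obtain rfl : a' = 0 := by
    have : a' * doubleArea A B C = 0 := by
      rw [← hE]
      obtain rfl : a' = 1 - b' - c' := by linarith
      simp only [doubleArea, PiLp.add_apply, PiLp.smul_apply, smul_eq_mul]
      ring
    exact (mul_eq_zero.1 this).resolve_right hABC
  obtain rfl : a = 1 - b := by linarith
  obtain rfl : c' = 1 - b' := by linarith
  have hb : b ≠ 0 := by
    rintro rfl
    exact hDA (by module)
  have hb1 : 1 - b ≠ 0 := by
    intro h
    obtain rfl : b = 1 := by linarith
    exact hDB (by module)
  have hb' : b' ≠ 0 := by
    rintro rfl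
    exact hEC (by module)
  have hb1' : 1 - b' ≠ 0 := by
    intro h
    obtain rfl : b' = 1 := by linarith
    exact hEB (by module)
  refine ⟨?_, ?_, ?_, ?_⟩
  · convert mul_ne_zero hb hABC using 1
    simp only [doubleArea, PiLp.add_apply, PiLp.smul_apply, smul_eq_mul]
    ring
  · convert mul_ne_zero (mul_ne_zero hb hb1') hABC using 1
    simp only [doubleArea, PiLp.add_apply, PiLp.smul_apply, smul_eq_mul]
    ring
  · convert mul_ne_zero (neg_ne_zero.2 hb') hABC using 1
    simp only [doubleArea, PiLp.add_apply, PiLp.smul_apply, smul_eq_mul]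
    ring
  · convert mul_ne_zero (mul_ne_zero (neg_ne_zero.2 hb1) hb') hABC using 1
    simp only [doubleArea, PiLp.add_apply, PiLp.smul_apply, smul_eq_mul]
    ring

theorem exists_not_mem_line_of_not_isCollinearPlusPoint {S : Set Plane} (h : ¬ Collinear ℝ S)
    (h' : ¬ IsCollinearPlusPoint S) {A B C : Plane} (hAB : A ≠ B) (hC : C ∈ S) :
    ∃ D ∈ S, doubleArea A B D ≠ 0 ∧ D ≠ C := by
  by_contra! hc
  have hS : insert C (S \ {C}) = S := by
    rw [Set.insert_sdiff_singleton, Set.insert_eq_of_mem hC]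
  refine h' ⟨S \ {C}, C, ?_, by rwa [hS], hS.symm⟩
  refine collinear_of_subset_line (A := A) (B := B) fun D hD => ?_
  by_contra hDl
  exact hD.2 (hc D hD.1 fun h0 => hDl ((mem_line_iff hAB).2 h0))

/-- If every point of `S` lies on a side line of a triangle `ABC` but two points other than the
vertices lie on different side lines, then these two and the vertices not shared by the two side
lines are in general position. -/
theorem exists_inGeneralPosition {S : Set Plane} (h : ¬ Collinear ℝ S)
    (h' : ¬ IsCollinearPlusPoint S) :
    ∃ A ∈ S, ∃ B ∈ S, ∃ C ∈ S, ∃ D ∈ S, InGeneralPosition A B C D := by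
  obtain ⟨A, hA, B, hB, C, hC, hABC⟩ := exists_doubleArea_ne_zero h
  by_contra! hno
  have hside : ∀ D ∈ S, doubleArea A B D = 0 ∨ doubleArea A C D = 0 ∨ doubleArea B C D = 0 := by
    intro D hD
    by_contra! hc
    exact hno A hA B hB C hC D hD ⟨hABC, hc.1, hc.2.1, hc.2.2⟩
  have hsymm : ∀ P Q X, doubleArea Q P X = 0 ↔ doubleArea P Q X = 0 := by
    intro P Q X
    unfold doubleArea
    constructor <;> intro <;> linarith
  have hCAB : doubleArea C A B ≠ 0 := fun h => hABC (by unfold doubleArea at *; linarith)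
  have hBCA : doubleArea B C A ≠ 0 := fun h => hABC (by unfold doubleArea at *; linarith)
  have hAB : A ≠ B := ne_of_doubleArea_ne_zero hABC
  have hBC : B ≠ C := ne_of_doubleArea_ne_zero hBCA
  have hCA : C ≠ A := ne_of_doubleArea_ne_zero hCAB
  have hAA : ∀ P Q, doubleArea P Q P = 0 ∧ doubleArea P Q Q = 0 := by
    intro P Q
    unfold doubleArea
    constructor <;> ring
  have hAB_BC : ∀ D ∈ S, ∀ E ∈ S, doubleArea A B D = 0 → D ≠ A → D ≠ B →
      doubleArea B C E = 0 → E ≠ B → E ≠ C → False := fun D hD E hE h1 h2 h3 h4 h5 h6 =>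
    hno A hA D hD C hC E hE (inGeneralPosition_of_mem_sides hABC h1 h2 h3 h4 h5 h6)
  have hBC_CA : ∀ D ∈ S, ∀ E ∈ S, doubleArea B C D = 0 → D ≠ B → D ≠ C →
      doubleArea C A E = 0 → E ≠ C → E ≠ A → False := fun D hD E hE h1 h2 h3 h4 h5 h6 =>
    hno B hB D hD A hA E hE (inGeneralPosition_of_mem_sides hBCA h1 h2 h3 h4 h5 h6)
  have hCA_AB : ∀ D ∈ S, ∀ E ∈ S, doubleArea C A D = 0 → D ≠ C → D ≠ A →
      doubleArea A B E = 0 → E ≠ A → E ≠ B → False := fun D hD E hE h1 h2 h3 h4 h5 h6 =>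
    hno C hC D hD B hB E hE (inGeneralPosition_of_mem_sides hCAB h1 h2 h3 h4 h5 h6)
  obtain ⟨D, hD, hD1, hD2⟩ := exists_not_mem_line_of_not_isCollinearPlusPoint h h' hAB hC
  obtain ⟨E, hE, hE1, hE2⟩ := exists_not_mem_line_of_not_isCollinearPlusPoint h h' hBC hA
  obtain ⟨F, hF, hF1, hF2⟩ := exists_not_mem_line_of_not_isCollinearPlusPoint h h' hCA hB
  have hDA : D ≠ A := fun e => hD1 (e ▸ (hAA A B).1)
  have hDB : D ≠ B := fun e => hD1 (e ▸ (hAA A B).2)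
  have hEB : E ≠ B := fun e => hE1 (e ▸ (hAA B C).1)
  have hEC : E ≠ C := fun e => hE1 (e ▸ (hAA B C).2)
  have hFC : F ≠ C := fun e => hF1 (e ▸ (hAA C A).1)
  have hFA : F ≠ A := fun e => hF1 (e ▸ (hAA C A).2)
  have hsD := hside D hD
  have hsE := hside E hE
  have hsF := hside F hF
  rw [← hsymm A C] at hsD hsE hsF
  rcases hsD with hD0 | hD0 | hD0
  · exact hD1 hD0
  · rcases hsF with hF0 | hF0 | hF0
    · exact hCA_AB D hD F hF hD0 hD2 hDA hF0 hFA hF2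
    · exact hF1 hF0
    · exact hBC_CA F hF D hD hF0 hF2 hFC hD0 hD2 hDA
  · rcases hsE with hE0 | hE0 | hE0
    · exact hAB_BC E hE D hD hE0 hE2 hEB hD0 hDB hD2
    · exact hBC_CA D hD E hE hD0 hDB hD2 hE0 hEC hE2
    · exact hE1 hE0

/-! ### Parallelograms -/

/-- The point with coordinates `(s, t)` in the affine frame in which `A`, `B` and `D` are `(0, 0)`,
`(1, 0)` and `(0, 1)`. -/
noncomputable def affinePoint (A B D : Plane) (s t : ℝ) : Plane :=
  A + s • (B - A) + t • (D - A)

section AffineFrame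

variable {A B D : Plane}

theorem doubleArea_affinePoint (s t s' t' s'' t'' : ℝ) :
    doubleArea (affinePoint A B D s t) (affinePoint A B D s' t') (affinePoint A B D s'' t'') =
      ((s' - s) * (t'' - t) - (t' - t) * (s'' - s)) * doubleArea A B D := by
  simp only [doubleArea, affinePoint, PiLp.add_apply, PiLp.sub_apply, PiLp.smul_apply, smul_eq_mul]
  ring

theorem affinePoint_inj (h : doubleArea A B D ≠ 0) {s t s' t' : ℝ} :
    affinePoint A B D s t = affinePoint A B D s' t' ↔ s = s' ∧ t = t' := by
  constructor
  · intro he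
    constructor
    · apply mul_right_cancel₀ h
      have h0 := doubleArea_affinePoint (A := A) (B := B) (D := D) 0 0 s t 0 1
      have h1 := doubleArea_affinePoint (A := A) (B := B) (D := D) 0 0 s' t' 0 1
      rw [he] at h0
      linarith
    · apply mul_right_cancel₀ h
      have h0 := doubleArea_affinePoint (A := A) (B := B) (D := D) 0 0 1 0 s t
      have h1 := doubleArea_affinePoint (A := A) (B := B) (D := D) 0 0 1 0 s' t'
      rw [he] at h0
      linarith
  · rintro ⟨rfl, rfl⟩
    rfl

theorem exists_eq_affinePoint (h : doubleArea A B D ≠ 0) (X : Plane) :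
    ∃ s t : ℝ, X = affinePoint A B D s t := by
  obtain ⟨a, b, c, habc, rfl⟩ := exists_barycentric h X
  obtain rfl : a = 1 - b - c := by linarith
  refine ⟨b, c, ?_⟩
  unfold affinePoint
  module

theorem affinePoint_mem_line_iff (h : doubleArea A B D ≠ 0) {s t s' t' x y : ℝ}
    (hne : affinePoint A B D s t ≠ affinePoint A B D s' t') :
    affinePoint A B D x y ∈ affineSpan ℝ {affinePoint A B D s t, affinePoint A B D s' t'} ↔
      (s' - s) * (y - t) - (t' - t) * (x - s) = 0 := by
  rw [mem_line_iff hne, doubleArea_affinePoint]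
  simp [h]

theorem dense_of_affinePoint_mem {U : Set Plane} (hU : lineIntersections U ⊆ U)
    (h : doubleArea A B D ≠ 0) {s₁ t₁ s₂ t₂ s₃ t₃ s t : ℝ}
    (m₁ : affinePoint A B D s₁ t₁ ∈ U) (m₂ : affinePoint A B D s₂ t₂ ∈ U)
    (m₃ : affinePoint A B D s₃ t₃ ∈ U) (m : affinePoint A B D s t ∈ U)
    (h₁₂₃ : (s₂ - s₁) * (t₃ - t₁) - (t₂ - t₁) * (s₃ - s₁) ≠ 0)
    (h₁₂ : (s₂ - s₁) * (t - t₁) - (t₂ - t₁) * (s - s₁) ≠ 0)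
    (h₁₃ : (s₃ - s₁) * (t - t₁) - (t₃ - t₁) * (s - s₁) ≠ 0)
    (h₂₃ : (s₃ - s₂) * (t - t₂) - (t₃ - t₂) * (s - s₂) ≠ 0)
    (n₃ : ¬ (s = s₁ + s₂ - s₃ ∧ t = t₁ + t₂ - t₃)) (n₂ : ¬ (s = s₁ + s₃ - s₂ ∧ t = t₁ + t₃ - t₂))
    (n₁ : ¬ (s = s₂ + s₃ - s₁ ∧ t = t₂ + t₃ - t₁)) : Dense U := by
  have hpar : ∀ {x y x' y' x'' y'' : ℝ}, ¬ (s = x + x' - x'' ∧ t = y + y' - y'') →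
      affinePoint A B D s t + affinePoint A B D x'' y'' ≠
        affinePoint A B D x y + affinePoint A B D x' y' := by
    intro x y x' y' x'' y'' hn he
    apply hn
    rw [← affinePoint_inj h, eq_sub_of_add_eq he]
    unfold affinePoint
    module
  refine dense_of_inGeneralPosition hU m₁ m₂ m₃ m ⟨?_, ?_, ?_, ?_⟩ (hpar n₃) (hpar n₂) (hpar n₁)
  all_goals
    rw [doubleArea_affinePoint]
    apply mul_ne_zero _ h
    assumption

/-- A fifth point `(s, t)`, other than the center, forms with three suitable vertices of the
parallelogram `(0, 0)`, `(1, 0)`, `(1, 1)`, `(0, 1)` a quadrilateral that is not a parallelogram. -/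
theorem dense_of_parallelogram_and_point {U : Set Plane} (hU : lineIntersections U ⊆ U)
    (h : doubleArea A B D ≠ 0) (m₀₀ : affinePoint A B D 0 0 ∈ U) (m₁₀ : affinePoint A B D 1 0 ∈ U)
    (m₁₁ : affinePoint A B D 1 1 ∈ U) (m₀₁ : affinePoint A B D 0 1 ∈ U) {s t : ℝ}
    (m : affinePoint A B D s t ∈ U) (n₀₀ : ¬ (s = 0 ∧ t = 0)) (n₁₀ : ¬ (s = 1 ∧ t = 0))
    (n₁₁ : ¬ (s = 1 ∧ t = 1)) (n₀₁ : ¬ (s = 0 ∧ t = 1)) (nO : ¬ (s = 1 / 2 ∧ t = 1 / 2)) :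
    Dense U := by
  have h₁ : t ≠ 0 → s ≠ t → s ≠ 1 → ¬ (s = 0 ∧ t = -1) → ¬ (s = 2 ∧ t = 1) → Dense U := by
    intro h1 h2 h3 h4 h5
    apply dense_of_affinePoint_mem hU h m₀₀ m₁₀ m₁₁ m <;> grind
  have h₂ : s ≠ 0 → s ≠ t → t ≠ 1 → ¬ (s = -1 ∧ t = 0) → ¬ (s = 1 ∧ t = 2) → Dense U := by
    intro h1 h2 h3 h4 h5
    apply dense_of_affinePoint_mem hU h m₀₀ m₀₁ m₁₁ m <;> grind
  have h₃ : s ≠ 0 → t ≠ 0 → s + t ≠ 1 → ¬ (s = 1 ∧ t = -1) → ¬ (s = -1 ∧ t = 1) → Dense U := by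
    intro h1 h2 h3 h4 h5
    apply dense_of_affinePoint_mem hU h m₀₀ m₁₀ m₀₁ m <;> grind
  have h₄ : s ≠ 1 → t ≠ 1 → s + t ≠ 1 → ¬ (s = 2 ∧ t = 0) → ¬ (s = 0 ∧ t = 2) → Dense U := by
    intro h1 h2 h3 h4 h5
    apply dense_of_affinePoint_mem hU h m₁₀ m₁₁ m₀₁ m <;> grind
  grind

/-- The lines through two points of the square `(0, 0)`, `(1, 0)`, `(1, 1)`, `(0, 1)` with its
center are the four sides and the two diagonals, given here by their equations. -/
theorem exists_equation_of_mem_linesOf (h : doubleArea A B D ≠ 0) {L : AffineSubspace ℝ Plane}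
    (hL : L ∈ linesOf {affinePoint A B D 0 0, affinePoint A B D 1 0, affinePoint A B D 1 1,
      affinePoint A B D 0 1, affinePoint A B D (1 / 2) (1 / 2)}) :
    ∃ k : Fin 6, ∀ s t : ℝ, affinePoint A B D s t ∈ L ↔
      ![s, t, s - 1, t - 1, s - t, s + t - 1] k = 0 := by
  obtain ⟨P, hP, Q, hQ, hPQ, rfl⟩ := hL
  obtain ⟨s', t', hP', rfl⟩ : ∃ s t : ℝ, ((s = 0 ∧ t = 0) ∨ (s = 1 ∧ t = 0) ∨ (s = 1 ∧ t = 1) ∨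
      (s = 0 ∧ t = 1) ∨ (s = 1 / 2 ∧ t = 1 / 2)) ∧ P = affinePoint A B D s t := by
    rcases hP with rfl | rfl | rfl | rfl | rfl <;> exact ⟨_, _, by norm_num, rfl⟩
  obtain ⟨s'', t'', hQ', rfl⟩ : ∃ s t : ℝ, ((s = 0 ∧ t = 0) ∨ (s = 1 ∧ t = 0) ∨ (s = 1 ∧ t = 1) ∨
      (s = 0 ∧ t = 1) ∨ (s = 1 / 2 ∧ t = 1 / 2)) ∧ Q = affinePoint A B D s t := by
    rcases hQ with rfl | rfl | rfl | rfl | rfl <;> exact ⟨_, _, by norm_num, rfl⟩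
  simp only [affinePoint_mem_line_iff h hPQ]
  rw [Ne, affinePoint_inj h] at hPQ
  clear hP hQ
  rcases hP' with ⟨rfl, rfl⟩ | ⟨rfl, rfl⟩ | ⟨rfl, rfl⟩ | ⟨rfl, rfl⟩ | ⟨rfl, rfl⟩ <;>
    rcases hQ' with ⟨rfl, rfl⟩ | ⟨rfl, rfl⟩ | ⟨rfl, rfl⟩ | ⟨rfl, rfl⟩ | ⟨rfl, rfl⟩ <;>
    first
    | exact absurd ⟨rfl, rfl⟩ hPQ
    | (refine ⟨0, fun s t => ?_⟩; change _ ↔ s = 0; constructor <;> intro <;> linarith)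
    | (refine ⟨1, fun s t => ?_⟩; change _ ↔ t = 0; constructor <;> intro <;> linarith)
    | (refine ⟨2, fun s t => ?_⟩; change _ ↔ s - 1 = 0; constructor <;> intro <;> linarith)
    | (refine ⟨3, fun s t => ?_⟩; change _ ↔ t - 1 = 0; constructor <;> intro <;> linarith)
    | (refine ⟨4, fun s t => ?_⟩; change _ ↔ s - t = 0; constructor <;> intro <;> linarith)
    | (refine ⟨5, fun s t => ?_⟩; change _ ↔ s + t - 1 = 0; constructor <;> intro <;> linarith)

theorem lineIntersections_parallelogram_subset (h : doubleArea A B D ≠ 0) :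
    lineIntersections {affinePoint A B D 0 0, affinePoint A B D 1 0, affinePoint A B D 1 1,
      affinePoint A B D 0 1, affinePoint A B D (1 / 2) (1 / 2)} ⊆
    {affinePoint A B D 0 0, affinePoint A B D 1 0, affinePoint A B D 1 1,
      affinePoint A B D 0 1, affinePoint A B D (1 / 2) (1 / 2)} := by
  rintro X ⟨L, hL, M, hM, hLM, hXL, hXM⟩
  obtain ⟨k, hk⟩ := exists_equation_of_mem_linesOf h hL
  obtain ⟨l, hl⟩ := exists_equation_of_mem_linesOf h hM
  obtain ⟨s, t, rfl⟩ := exists_eq_affinePoint h X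
  have hkl : k ≠ l := by
    rintro rfl
    apply hLM
    ext Y
    obtain ⟨s, t, rfl⟩ := exists_eq_affinePoint h Y
    rw [hk, hl]
  rw [hk] at hXL
  rw [hl] at hXM
  simp only [Set.mem_insert_iff, Set.mem_singleton_iff, affinePoint_inj h]
  clear hk hl hL hM hLM
  fin_cases k <;> fin_cases l <;> simp at hkl hXL hXM <;> grind

end AffineFrame

theorem IsParallelogram.doubleArea_ne_zero {A B C D : Plane} (h : IsParallelogram A B C D) :
    doubleArea A B D ≠ 0 := by
  have h1 := affineIndependent_iff_doubleArea_ne_zero.1 h.1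
  have hD : D = C - B + A := by
    rw [eq_comm, sub_add, h.2]
    abel
  intro h0
  apply h1
  rw [← h0, hD]
  simp only [doubleArea, PiLp.add_apply, PiLp.sub_apply]
  ring

theorem affinePoint_zero_zero (A B D : Plane) : affinePoint A B D 0 0 = A := by
  simp [affinePoint]

theorem affinePoint_one_zero (A B D : Plane) : affinePoint A B D 1 0 = B := by
  simp [affinePoint]

theorem affinePoint_zero_one (A B D : Plane) : affinePoint A B D 0 1 = D := by
  simp [affinePoint]

theorem affinePoint_one_one {A B C D : Plane} (h : B - A = C - D) : affinePoint A B D 1 1 = C := by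
  have : C = B - A + D := by rw [h, sub_add_cancel]
  rw [this]
  unfold affinePoint
  module

theorem affinePoint_mem_segment_left {A B C D : Plane} (h : B - A = C - D) :
    affinePoint A B D (1 / 2) (1 / 2) ∈ segment ℝ A C := by
  refine ⟨1 / 2, 1 / 2, by norm_num, by norm_num, by norm_num, ?_⟩
  have : C = B - A + D := by rw [h, sub_add_cancel]
  rw [this]
  unfold affinePoint
  module

theorem affinePoint_mem_segment_right {A B D : Plane} :
    affinePoint A B D (1 / 2) (1 / 2) ∈ segment ℝ B D := by
  refine ⟨1 / 2, 1 / 2, by norm_num, by norm_num, by norm_num, ?_⟩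
  unfold affinePoint
  module

theorem IsParallelogram.segment_inter_segment {A B C D : Plane} (h : IsParallelogram A B C D) :
    segment ℝ A C ∩ segment ℝ B D = {affinePoint A B D (1 / 2) (1 / 2)} := by
  apply Set.Subset.antisymm
  · rintro X ⟨⟨a, b, -, -, hab, hX⟩, ⟨c, d, -, -, hcd, hX'⟩⟩
    have hC : C = B - A + D := by rw [h.2, sub_add_cancel]
    have h1 : X = affinePoint A B D b b := by
      obtain rfl : a = 1 - b := by linarith
      rw [← hX, hC]
      unfold affinePoint
      module
    have h2 : X = affinePoint A B D c d := by
      obtain rfl : c = 1 - d := by linarith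
      rw [← hX']
      unfold affinePoint
      module
    obtain ⟨hbc, hbd⟩ := (affinePoint_inj h.doubleArea_ne_zero).1 (h1.symm.trans h2)
    obtain rfl : b = 1 / 2 := by linarith
    exact h1
  · rintro X rfl
    exact ⟨affinePoint_mem_segment_left h.2, affinePoint_mem_segment_right⟩

theorem dense_of_isParallelogram {S U : Set Plane} (hU : lineIntersections U ⊆ U) (hSU : S ⊆ U)
    {A B C D : Plane} (hA : A ∈ S) (hB : B ∈ S) (hC : C ∈ S) (hD : D ∈ S)
    (h : IsParallelogram A B C D) (h4 : ¬ IsParallelogramVertices S)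
    (h5 : ¬ IsParallelogramVerticesWithCenter S) : Dense U := by
  have hABD := h.doubleArea_ne_zero
  obtain ⟨X, hX, hXA, hXB, hXC, hXD, hXO⟩ : ∃ X ∈ S, X ≠ A ∧ X ≠ B ∧ X ≠ C ∧ X ≠ D ∧
      X ≠ affinePoint A B D (1 / 2) (1 / 2) := by
    by_contra! hc
    by_cases hO : affinePoint A B D (1 / 2) (1 / 2) ∈ S
    · refine h5 ⟨A, B, C, D, _, h, h.segment_inter_segment, Set.Subset.antisymm ?_ ?_⟩
      · intro X hX
        simp only [Set.mem_insert_iff, Set.mem_singleton_iff]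
        have := hc X hX
        tauto
      · rintro X (rfl | rfl | rfl | rfl | rfl) <;> assumption
    · refine h4 ⟨A, B, C, D, h, Set.Subset.antisymm ?_ ?_⟩
      · intro X hX
        simp only [Set.mem_insert_iff, Set.mem_singleton_iff]
        have := hc X hX
        have : X ≠ affinePoint A B D (1 / 2) (1 / 2) := fun e => hO (e ▸ hX)
        tauto
      · rintro X (rfl | rfl | rfl | rfl) <;> assumption
  obtain ⟨s, t, rfl⟩ := exists_eq_affinePoint hABD X
  refine dense_of_parallelogram_and_point hU hABD ?_ ?_ ?_ ?_ (hSU hX) ?_ ?_ ?_ ?_ ?_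
  · rw [affinePoint_zero_zero]
    exact hSU hA
  · rw [affinePoint_one_zero]
    exact hSU hB
  · rw [affinePoint_one_one h.2]
    exact hSU hC
  · rw [affinePoint_zero_one]
    exact hSU hD
  · rintro ⟨rfl, rfl⟩
    exact hXA (affinePoint_zero_zero A B D)
  · rintro ⟨rfl, rfl⟩
    exact hXB (affinePoint_one_zero A B D)
  · rintro ⟨rfl, rfl⟩
    exact hXC (affinePoint_one_one h.2)
  · rintro ⟨rfl, rfl⟩
    exact hXD (affinePoint_zero_one A B D)
  · rintro ⟨rfl, rfl⟩
    exact hXO rfl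

theorem not_dense_of_subset_parallelogram {S : Set Plane} {A B C D : Plane}
    (h : IsParallelogram A B C D)
    (hS : S ⊆ {A, B, C, D, affinePoint A B D (1 / 2) (1 / 2)}) :
    ¬ Dense (⋃ i : ℕ, lineIntersections^[i] S) := by
  have hF := lineIntersections_parallelogram_subset h.doubleArea_ne_zero
  rw [affinePoint_zero_zero, affinePoint_one_zero, affinePoint_one_one h.2,
    affinePoint_zero_one] at hF
  exact not_dense_iUnion_of_subset (Set.toFinite _) hS hF

/-! ### Collinear sets with at most one further point -/

theorem lineIntersections_subset_of_collinear {S : Set Plane} (h : Collinear ℝ S) :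
    lineIntersections S ⊆ S := by
  rintro X ⟨L, ⟨P, hP, Q, hQ, hPQ, rfl⟩, M, ⟨R, hR, V, hV, hRV, rfl⟩, hLM, -⟩
  refine absurd (affineSpan_pair_eq_of_mem_of_mem_of_ne ?_ ?_ hPQ) hLM
  · exact h.mem_affineSpan_of_mem_of_ne hR hV hP hRV
  · exact h.mem_affineSpan_of_mem_of_ne hR hV hQ hRV

theorem lineIntersections_subset_of_isCollinearPlusPoint {S : Set Plane}
    (h : IsCollinearPlusPoint S) : lineIntersections S ⊆ S := by
  obtain ⟨R, X, hR, hRX, rfl⟩ := h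
  have hXR : X ∉ affineSpan ℝ R := fun hX =>
    hRX ((collinear_insert_iff_of_mem_affineSpan hX).2 hR)
  have hlines : ∀ L ∈ linesOf (insert X R), L = affineSpan ℝ R ∨
      ∃ P ∈ R, X ∈ L ∧ P ∈ L := by
    rintro L ⟨P, hP, Q, hQ, hPQ, rfl⟩
    rcases hP with rfl | hP
    · rcases hQ with rfl | hQ
      · exact absurd rfl hPQ
      · exact Or.inr ⟨Q, hQ, left_mem_affineSpan_pair ℝ _ _, right_mem_affineSpan_pair ℝ _ _⟩
    · rcases hQ with rfl | hQ
      · exact Or.inr ⟨P, hP, right_mem_affineSpan_pair ℝ _ _, left_mem_affineSpan_pair ℝ _ _⟩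
      · exact Or.inl (hR.affineSpan_eq_of_ne hP hQ hPQ)
  rintro Y ⟨L, hL, M, hM, hLM, hYL, hYM⟩
  rcases hlines L hL with hL' | ⟨P, hP, hXL, hPL⟩ <;>
    rcases hlines M hM with hM' | ⟨Q, hQ, hXM, hQM⟩
  · exact absurd (hL'.trans hM'.symm) hLM
  · have : Y = Q := eq_of_mem_linesOf hL hM hLM hYL hYM
      (hL' ▸ subset_affineSpan ℝ R hQ) hQM
    exact Or.inr (this ▸ hQ)
  · have : Y = P := eq_of_mem_linesOf hL hM hLM hYL hYM hPL
      (hM' ▸ subset_affineSpan ℝ R hP)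
    exact Or.inr (this ▸ hP)
  · exact Or.inl (eq_of_mem_linesOf hL hM hLM hYL hYM hXL hXM)

/-! ### The dichotomy -/

theorem corollary1p2 (S : Set Plane) (hS : S.Finite) :
    Dense (⋃ i : ℕ, lineIntersections^[i] S) ↔
      ¬ (S = ∅ ∨
        Collinear ℝ S ∨
        IsCollinearPlusPoint S ∨
        IsParallelogramVertices S ∨
        IsParallelogramVerticesWithCenter S) := by
  constructor
  · rintro hd (h | h | h | ⟨A, B, C, D, h, rfl⟩ | ⟨A, B, C, D, O, h, hO, rfl⟩)
    · refine not_dense_iUnion_of_subset hS subset_rfl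
        (lineIntersections_subset_of_collinear ?_) hd
      rw [h]
      exact collinear_empty ℝ Plane
    · exact not_dense_iUnion_of_subset hS subset_rfl (lineIntersections_subset_of_collinear h) hd
    · exact not_dense_iUnion_of_subset hS subset_rfl
        (lineIntersections_subset_of_isCollinearPlusPoint h) hd
    · refine not_dense_of_subset_parallelogram h ?_ hd
      rintro X (rfl | rfl | rfl | rfl) <;> simp
    · rw [h.segment_inter_segment, Set.singleton_eq_singleton_iff] at hO
      exact not_dense_of_subset_parallelogram h (by rw [hO]) hd
  · intro h
    simp only [not_or] at h
    obtain ⟨-, h2, h3, h4, h5⟩ := h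
    have hU := lineIntersections_iUnion_subset h2
    have hSU : S ⊆ ⋃ i : ℕ, lineIntersections^[i] S :=
      Set.subset_iUnion (fun i : ℕ => lineIntersections^[i] S) 0
    obtain ⟨A, hA, B, hB, C, hC, D, hD, hgen⟩ := exists_inGeneralPosition h2 h3
    have hABC := affineIndependent_iff_doubleArea_ne_zero.2 hgen.1
    by_contra hd
    have key : D + C ≠ A + B ∧ D + B ≠ A + C ∧ D + A ≠ B + C := by
      refine ⟨fun he => hd ?_, fun he => hd ?_, fun he => hd ?_⟩
      · refine dense_of_isParallelogram hU hSU hA hC hB hD ⟨?_, ?_⟩ h4 h5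
        · rw [affineIndependent_iff_doubleArea_ne_zero]
          intro h0
          apply hgen.1
          unfold doubleArea at *
          linarith
        · rw [sub_eq_sub_iff_add_eq_add, add_comm C, add_comm B, he]
      · refine dense_of_isParallelogram hU hSU hA hB hC hD ⟨hABC, ?_⟩ h4 h5
        rw [sub_eq_sub_iff_add_eq_add, add_comm B, add_comm C, he]
      · refine dense_of_isParallelogram hU hSU hB hA hC hD ⟨?_, ?_⟩ h4 h5
        · rw [affineIndependent_iff_doubleArea_ne_zero]
          intro h0
          apply hgen.1
          unfold doubleArea at *
          linarith
        · rw [sub_eq_sub_iff_add_eq_add, add_comm A, add_comm C, he]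
    exact hd (dense_of_inGeneralPosition hU (hSU hA) (hSU hB) (hSU hC) (hSU hD) hgen key.1 key.2.1
      key.2.2)
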